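/- For integers $n\ge 1$ and $j\ge 0$ let $$\zeta_n^{\star}(\{2\}_j)=\sum_{n\ge k_1\ge\dots\ge k_j\ge 1}\ \prod_{i=1}^j\frac{1}{k_i^2}$$ be the multiple harmonic star sum of depth $j$ and weight $2j$ (so that $\zeta_n^{\star}(\{2\}_0)=1$), and for real $s>0$ let $$\eta(s)=\sum_{k=1}^{\infty}\frac{(-1)^{k-1}}{k^s}$$ be the Dirichlet eta function (the sum of the series being the limit of its partial sums in the natural order). Then for every integer $j\ge 0$ the following series converges, and $$\sum_{n=1}^{\infty}\frac{\binom{2n}{n}}{n\,4^n}\,\zeta_n^{\star}(\{2\}_j)=2\,\eta(2j+1).$$ -/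

import Mathlib

/-- The multiple harmonic star sum `ζ_n^⋆({2}_j)` of depth `j` and weight `2j`: the sum over all
integer tuples `n ≥ k_1 ≥ ⋯ ≥ k_j ≥ 1` of `∏ i, 1 / k_i ^ 2`. For `j = 0` there is exactly one
(empty) tuple, and the value is `1`. -/
noncomputable def zetaStarTwo (n j : ℕ) : ℝ :=
  ∑ k ∈ (Fintype.piFinset fun _ : Fin j => Finset.Icc 1 n) with
      (∀ a b : Fin j, a ≤ b → k b ≤ k a),
    ∏ i : Fin j, 1 / (k i : ℝ) ^ 2

/-- The Dirichlet eta function at a real `s > 0`: `η(s) = ∑_{k ≥ 1} (-1)^(k-1) / k^s`, the limit of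
the partial sums in the natural order (the series converges only conditionally for `s ≤ 1`).
The index is shifted by one, so that `k` stands for `k + 1`. -/
noncomputable def dirichletEta (s : ℝ) : ℝ :=
  Filter.atTop.limUnder fun N : ℕ =>
    ∑ k ∈ Finset.range N, (-1 : ℝ) ^ k / ((k : ℝ) + 1) ^ s

/-- For `s > 0` the limit that defines `dirichletEta s` exists. -/
theorem tendsto_dirichletEta {s : ℝ} (hs : 0 < s) :
    Filter.Tendsto (fun N : ℕ => ∑ k ∈ Finset.range N, (-1 : ℝ) ^ k / ((k : ℝ) + 1) ^ s)
      Filter.atTop (nhds (dirichletEta s)) := by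
  have hanti : Antitone fun k : ℕ => (((k : ℝ) + 1) ^ s)⁻¹ := by
    intro a b hab
    have hab' : (a : ℝ) ≤ b := by exact_mod_cast hab
    have ha : (0 : ℝ) < (a : ℝ) + 1 := by positivity
    exact inv_anti₀ (Real.rpow_pos_of_pos ha s)
      (Real.rpow_le_rpow ha.le (by linarith) hs.le)
  have hlim : Filter.Tendsto (fun k : ℕ => (((k : ℝ) + 1) ^ s)⁻¹) Filter.atTop (nhds 0) :=
    ((tendsto_rpow_atTop hs).comp
      (Filter.tendsto_atTop_add_const_right _ 1 tendsto_natCast_atTop_atTop)).inv_tendsto_atTop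
  obtain ⟨l, hl⟩ := hanti.tendsto_alternating_series_of_tendsto_zero hlim
  exact tendsto_nhds_limUnder ⟨l, by simpa only [div_eq_mul_inv] using hl⟩

open Finset Filter Topology

/-! Partial fractions (`choose_mul_zetaStarTwo`) turn the star sum into an alternating sum over `k`
of `binom(2n, n+k) / k^(2j)`. Exchanging finite sums leaves, for each `k`, the sum over `n ≤ N` of
`binom(2n, n+k) / (n 4^n)`. Up to the factor `k`, its terms are first-passage probabilities of a
random walk, so it telescopes to `(1 - walkBelow N k) / k`. As `N → ∞` this tends to `1 / k`,
producing eta at `2j + 1`. Since that series may converge only conditionally, the limit is taken by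
`tendsto_alternating_sum`, using monotonicity in `k`. -/

theorem zetaStarTwo_zero_right (n : ℕ) : zetaStarTwo n 0 = 1 := by
  simp [zetaStarTwo]

theorem zetaStarTwo_zero_left (j : ℕ) : zetaStarTwo 0 (j + 1) = 0 := by
  simp [zetaStarTwo]

/-- Splitting the tuples according to whether the largest entry equals `n + 1`. -/
theorem zetaStarTwo_succ_succ (n j : ℕ) :
    zetaStarTwo (n + 1) (j + 1) =
      zetaStarTwo n (j + 1) + zetaStarTwo (n + 1) j / ((n : ℝ) + 1) ^ 2 := by
  have hdiv : zetaStarTwo (n + 1) j / ((n : ℝ) + 1) ^ 2 =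
      ∑ k ∈ ((Fintype.piFinset fun _ : Fin (j + 1) => Icc 1 (n + 1)).filter
        fun k => ∀ a b : Fin (j + 1), a ≤ b → k b ≤ k a).filter fun k => k 0 = n + 1,
        ∏ i, 1 / (k i : ℝ) ^ 2 := by
    rw [zetaStarTwo, sum_div]
    refine sum_bij' (fun k _ => Fin.cons (n + 1) k) (fun k _ => Fin.tail k) ?_ ?_ ?_ ?_ ?_
    · intro k hk
      simp only [mem_filter, Fintype.mem_piFinset, mem_Icc] at hk ⊢
      refine ⟨⟨fun i => ?_, fun a b hab => ?_⟩, by simp⟩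
      · refine Fin.cases (by simp) (fun i => ?_) i
        simpa using hk.1 i
      · revert hab
        refine Fin.cases ?_ (fun b => ?_) b
        · intro hab
          rw [Fin.le_zero_iff.1 hab]
        · refine Fin.cases (fun _ => ?_) (fun a hab => ?_) a
          · simpa using (hk.1 b).2
          · simpa using hk.2 a b (by simpa using hab)
    · intro k hk
      simp only [mem_filter, Fintype.mem_piFinset, mem_Icc] at hk ⊢
      exact ⟨fun i => hk.1.1 i.succ, fun a b hab => hk.1.2 a.succ b.succ (by simpa using hab)⟩
    · intro k _
      simp
    · intro k hk
      simp only [mem_filter] at hk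
      rw [← hk.2]
      exact Fin.cons_self_tail k
    · intro k _
      rw [Fin.prod_univ_succ]
      simp [div_eq_mul_inv, mul_comm]
  have hrest : zetaStarTwo n (j + 1) =
      ∑ k ∈ ((Fintype.piFinset fun _ : Fin (j + 1) => Icc 1 (n + 1)).filter
        fun k => ∀ a b : Fin (j + 1), a ≤ b → k b ≤ k a).filter fun k => ¬ k 0 = n + 1,
        ∏ i, 1 / (k i : ℝ) ^ 2 := by
    rw [zetaStarTwo]
    refine sum_congr ?_ fun _ _ => rfl
    ext k
    simp only [mem_filter, Fintype.mem_piFinset, mem_Icc]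
    constructor
    · rintro ⟨h1, h2⟩
      exact ⟨⟨fun i => ⟨(h1 i).1, (h1 i).2.trans n.le_succ⟩, h2⟩, by have := h1 0; omega⟩
    · rintro ⟨⟨h1, h2⟩, h3⟩
      refine ⟨fun i => ⟨(h1 i).1, ?_⟩, h2⟩
      have := h2 0 i (Fin.zero_le i)
      have := h1 0
      omega
  rw [hdiv, hrest, zetaStarTwo, add_comm (∑ k ∈ _, _)]
  exact (sum_filter_add_sum_filter_not (M := ℝ) _
    (fun k : Fin (j + 1) → ℕ => k 0 = n + 1) _).symm

theorem zetaStarTwo_nonneg (n j : ℕ) : 0 ≤ zetaStarTwo n j :=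
  sum_nonneg fun _ _ => prod_nonneg fun _ _ => by positivity

theorem cast_choose_succ_right_mul (m r : ℕ) :
    (m.choose (r + 1) : ℝ) * ((r : ℝ) + 1) = (m.choose r : ℝ) * ((m : ℝ) - r) := by
  rcases le_or_gt r m with h | h
  · have := Nat.choose_succ_right_eq m r
    rw [← Nat.cast_sub h]
    exact_mod_cast this
  · simp [Nat.choose_eq_zero_of_lt h, Nat.choose_eq_zero_of_lt (h.trans r.lt_succ_self)]

/-- Kept free of division so that `k = n + 1`, where both sides vanish, is covered. -/
theorem choose_central_succ_mul (n k : ℕ) :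
    ((2 * (n + 1)).choose (n + 1 + k) : ℝ) * (((n : ℝ) + 1) ^ 2 - k ^ 2) =
      (2 * n).choose (n + k) * ((2 * n + 1) * (2 * n + 2)) := by
  have h1 : ((2 * n + 1).choose (n + k + 1) : ℝ) * ((n : ℝ) + k + 1) =
      (2 * n + 1) * (2 * n).choose (n + k) := by
    exact_mod_cast (Nat.add_one_mul_choose_eq (2 * n) (n + k)).symm
  have h2 := cast_choose_succ_right_mul (2 * n + 1) (n + k)
  have h3 : ((2 * n + 2).choose (n + k + 1) : ℝ) =
      (2 * n + 1).choose (n + k) + (2 * n + 1).choose (n + k + 1) := by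
    exact_mod_cast Nat.choose_succ_succ' (2 * n + 1) (n + k)
  rw [show 2 * (n + 1) = 2 * n + 2 by ring, show n + 1 + k = n + k + 1 by ring, h3]
  push_cast at h2
  linear_combination (2 * (n : ℝ) + 2) * h1 - ((n : ℝ) + 1 + k) * h2

theorem alternating_sum_choose_central (n K : ℕ) :
    ∑ k ∈ range K, (-1 : ℝ) ^ k * (2 * (n + 1)).choose (n + 1 + (k + 1)) =
      (2 * n + 1).choose (n + 1) - (-1) ^ K * (2 * n + 1).choose (n + 1 + K) := by
  induction K with
  | zero => simp
  | succ K ih =>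
    have h : ((2 * (n + 1)).choose (n + 1 + (K + 1)) : ℝ) =
        (2 * n + 1).choose (n + 1 + K) + (2 * n + 1).choose (n + 1 + (K + 1)) := by
      exact_mod_cast Nat.choose_succ_succ' (2 * n + 1) (n + 1 + K)
    rw [sum_range_succ, ih, h]
    ring

/-- The partial fraction expansion of `ζ_n^⋆({2}_j)`, multiplied by `binom(2n, n)`. -/
theorem choose_mul_zetaStarTwo (j n K : ℕ) (hn : n ≠ 0 ∨ j ≠ 0) (hK : n ≤ K) :
    ((2 * n).choose n : ℝ) * zetaStarTwo n j =
      2 * ∑ k ∈ range K, (-1 : ℝ) ^ k * (2 * n).choose (n + (k + 1)) / ((k : ℝ) + 1) ^ (2 * j) := by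
  induction j generalizing n with
  | zero =>
    obtain ⟨n, rfl⟩ : ∃ m, n = m + 1 := Nat.exists_eq_succ_of_ne_zero (by simpa using hn)
    have h : ((2 * (n + 1)).choose (n + 1) : ℝ) = 2 * (2 * n + 1).choose (n + 1) := by
      have h1 : (2 * (n + 1)).choose (n + 1) = (2 * n + 1).choose n + (2 * n + 1).choose (n + 1) :=
        Nat.choose_succ_succ' (2 * n + 1) n
      rw [← Nat.choose_symm_half n] at h1
      rw [h1]
      push_cast
      ring
    simp only [mul_zero, pow_zero, div_one]
    rw [alternating_sum_choose_central, zetaStarTwo_zero_right, h,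
      Nat.choose_eq_zero_of_lt (show 2 * n + 1 < n + 1 + K by omega)]
    simp
  | succ j ihj =>
    clear hn
    induction n with
    | zero =>
      rw [zetaStarTwo_zero_left, sum_eq_zero]
      · simp
      · intro k _
        simp
    | succ n ihn =>
      have h1 := ihn (by omega)
      have h2 := ihj (n + 1) (by simp) hK
      have hc : ((2 * (n + 1)).choose (n + 1) : ℝ) * ((n : ℝ) + 1) ^ 2 =
          (2 * n).choose n * ((2 * n + 1) * (2 * n + 2)) := by
        simpa using choose_central_succ_mul n 0
      have hn0 : ((n : ℝ) + 1) ^ 2 ≠ 0 := by positivity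
      have key : ((2 * (n + 1)).choose (n + 1) : ℝ) * zetaStarTwo (n + 1) (j + 1) *
          ((n : ℝ) + 1) ^ 2 = (2 * n + 1) * (2 * n + 2) * ((2 * n).choose n * zetaStarTwo n (j + 1))
            + (2 * (n + 1)).choose (n + 1) * zetaStarTwo (n + 1) j := by
        rw [zetaStarTwo_succ_succ]
        field_simp
        linear_combination zetaStarTwo n (j + 1) * hc
      rw [← mul_left_inj' hn0, key, h1, h2, mul_left_comm, ← mul_add, mul_assoc 2, sum_mul, mul_sum,
        ← sum_add_distrib]
      congr 1
      refine sum_congr rfl fun k _ => ?_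
      -- Write `(n+1)^2 = ((n+1)^2 - (k+1)^2) + (k+1)^2`: the first part gives the term for `n` at
      -- depth `j + 1`, the second the term for `n + 1` at depth `j`.
      have hk := choose_central_succ_mul n (k + 1)
      push_cast at hk
      have hk0 : ((k : ℝ) + 1) ≠ 0 := by positivity
      rw [show 2 * (j + 1) = 2 * j + 2 by ring, pow_add]
      field_simp
      linear_combination -hk

/-! ### First passage of the simple random walk -/

/-- The probability that a simple random walk is at `2 k` at time `2 n`. -/
noncomputable def walkProb (n k : ℕ) : ℝ := (2 * n).choose (n + k) / 4 ^ n

theorem walkProb_nonneg (n k : ℕ) : 0 ≤ walkProb n k := by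
  unfold walkProb
  positivity

/-- The probability that a simple random walk stays below `2 k` up to time `2 n`. -/
noncomputable def walkBelow (n k : ℕ) : ℝ := ∑ m ∈ range k, (walkProb n m + walkProb n (m + 1))

theorem walkBelow_nonneg (n k : ℕ) : 0 ≤ walkBelow n k :=
  sum_nonneg fun _ _ => add_nonneg (walkProb_nonneg _ _) (walkProb_nonneg _ _)

theorem walkBelow_mono (n : ℕ) : Monotone (walkBelow n) :=
  monotone_nat_of_le_succ fun k => by
    rw [walkBelow, walkBelow, sum_range_succ]
    linarith [walkProb_nonneg n k, walkProb_nonneg n (k + 1)]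

theorem walkBelow_zero_left (k : ℕ) : walkBelow 0 (k + 1) = 1 := by
  rw [walkBelow, sum_range_succ', sum_eq_zero]
  · simp [walkProb]
  · intro m _
    simp [walkProb]

/-- Hitting-time theorem: the decrease is the probability that level `2k` is first reached at time
`2n + 2`. -/
theorem walkBelow_sub_succ (n k : ℕ) :
    walkBelow n k - walkBelow (n + 1) k = k * (walkProb (n + 1) k / ((n : ℝ) + 1)) := by
  induction k with
  | zero => simp [walkBelow]
  | succ k ih =>
    have e : walkBelow n (k + 1) - walkBelow (n + 1) (k + 1) =
        (walkBelow n k - walkBelow (n + 1) k) + (walkProb n k + walkProb n (k + 1))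
          - (walkProb (n + 1) k + walkProb (n + 1) (k + 1)) := by
      simp only [walkBelow, sum_range_succ]
      ring
    have b1 := cast_choose_succ_right_mul (2 * n + 1) (n + k)
    have b2 := cast_choose_succ_right_mul (2 * n + 1) (n + k + 1)
    have s1 : ((2 * n + 1).choose (n + k + 1) : ℝ) =
        (2 * n).choose (n + k) + (2 * n).choose (n + (k + 1)) := by
      exact_mod_cast Nat.choose_succ_succ' (2 * n) (n + k)
    have s2 : ((2 * (n + 1)).choose (n + 1 + k) : ℝ) =
        (2 * n + 1).choose (n + k) + (2 * n + 1).choose (n + k + 1) := by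
      rw [show n + 1 + k = n + k + 1 by ring]
      exact_mod_cast Nat.choose_succ_succ' (2 * n + 1) (n + k)
    have s3 : ((2 * (n + 1)).choose (n + 1 + (k + 1)) : ℝ) =
        (2 * n + 1).choose (n + k + 1) + (2 * n + 1).choose (n + k + 1 + 1) := by
      rw [show n + 1 + (k + 1) = n + k + 1 + 1 by ring]
      exact_mod_cast Nat.choose_succ_succ' (2 * n + 1) (n + k + 1)
    have e' : walkProb n k + walkProb n (k + 1) = (2 * n + 1).choose (n + k + 1) / 4 ^ n := by
      rw [walkProb, walkProb, s1, add_div]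
    rw [e, e', ih]
    unfold walkProb
    rw [s2, s3, pow_succ]
    push_cast at b1 b2 ⊢
    field_simp
    linear_combination b1 - b2

theorem sum_walkProb_div (N k : ℕ) :
    ∑ n ∈ range N, walkProb (n + 1) (k + 1) / ((n : ℝ) + 1) =
      (1 - walkBelow N (k + 1)) / ((k : ℝ) + 1) := by
  rw [eq_div_iff (by positivity), sum_mul]
  have h := sum_range_sub' (fun n => walkBelow n (k + 1)) N
  rw [walkBelow_zero_left] at h
  rw [← h]
  refine sum_congr rfl fun n _ => ?_
  rw [walkBelow_sub_succ]
  push_cast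
  ring

theorem walkBelow_le_one (N k : ℕ) : walkBelow N (k + 1) ≤ 1 := by
  have h : 0 ≤ ∑ n ∈ range N, walkProb (n + 1) (k + 1) / ((n : ℝ) + 1) :=
    sum_nonneg fun n _ => div_nonneg (walkProb_nonneg _ _) (by positivity)
  rw [sum_walkProb_div] at h
  rw [le_div_iff₀ (by positivity), zero_mul] at h
  linarith

/-- The induction rests on `(2n+1)(2n+3) ≤ (2n+2)^2`. -/
theorem walkProb_zero_sq_mul_le (n : ℕ) : walkProb n 0 ^ 2 * (2 * n + 1) ≤ 1 := by
  induction n with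
  | zero => simp [walkProb]
  | succ n ih =>
    have hc := choose_central_succ_mul n 0
    have h : walkProb (n + 1) 0 = walkProb n 0 * ((2 * n + 1) / (2 * n + 2)) := by
      unfold walkProb
      rw [pow_succ]
      push_cast at hc ⊢
      field_simp
      have h1 : ((n : ℝ) + 1) ≠ 0 := by positivity
      refine mul_left_cancel₀ h1 ?_
      linear_combination 2 * hc
    rw [h]
    refine le_trans ?_ ih
    rw [mul_pow, mul_assoc]
    refine mul_le_mul_of_nonneg_left ?_ (sq_nonneg _)
    push_cast
    rw [div_pow, div_mul_eq_mul_div, div_le_iff₀ (by positivity)]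
    have : (0 : ℝ) ≤ n := n.cast_nonneg
    nlinarith

theorem tendsto_walkProb (k : ℕ) : Tendsto (fun n => walkProb n k) atTop (𝓝 0) := by
  have hle : ∀ n, walkProb n k ≤ walkProb n 0 := fun n => by
    unfold walkProb
    gcongr
    exact Nat.choose_le_centralBinom (n + k) n
  have hsq : Tendsto (fun n => walkProb n 0 ^ 2) atTop (𝓝 0) := by
    refine squeeze_zero (fun n => sq_nonneg _) (fun n => ?_)
      tendsto_one_div_add_atTop_nhds_zero_nat
    rw [le_div_iff₀ (by positivity)]
    refine le_trans (mul_le_mul_of_nonneg_left ?_ (sq_nonneg _)) (walkProb_zero_sq_mul_le n)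
    have : (0 : ℝ) ≤ n := n.cast_nonneg
    linarith
  have h0 : Tendsto (fun n => walkProb n 0) atTop (𝓝 0) := by
    have := hsq.sqrt
    simpa [Real.sqrt_sq (walkProb_nonneg _ _)] using this
  exact squeeze_zero (fun n => walkProb_nonneg n k) hle h0

theorem tendsto_walkBelow (k : ℕ) : Tendsto (fun n => walkBelow n k) atTop (𝓝 0) := by
  have := tendsto_finsetSum (range k) fun m _ => (tendsto_walkProb m).add (tendsto_walkProb (m + 1))
  simpa [walkBelow] using this

/-! ### Limits of alternating sums -/

theorem alternating_sum_mem_Icc (a : ℕ → ℝ) (ha : Antitone a) (h0 : ∀ k, 0 ≤ a k) (m : ℕ) :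
    ∑ i ∈ range m, (-1 : ℝ) ^ i * a i ∈ Set.Icc 0 (a 0) := by
  induction m generalizing a with
  | zero => simpa using h0 0
  | succ m ih =>
    have h := ih (fun i => a (i + 1)) (fun x y hxy => ha (by omega)) fun k => h0 _
    have e : ∑ i ∈ range (m + 1), (-1 : ℝ) ^ i * a i =
        a 0 - ∑ i ∈ range m, (-1 : ℝ) ^ i * a (i + 1) := by
      rw [sum_range_succ']
      simp only [pow_succ, pow_zero, one_mul, mul_neg, mul_one, neg_mul, sum_neg_distrib]
      ring
    have h1 := ha (Nat.zero_le 1)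
    simp only [Set.mem_Icc, zero_add] at h ⊢
    rw [e]
    constructor <;> linarith [h.1, h.2]

theorem abs_alternating_sum_Ico_le (a : ℕ → ℝ) (ha : Antitone a) (h0 : ∀ k, 0 ≤ a k) (K N : ℕ) :
    |∑ i ∈ Ico K N, (-1 : ℝ) ^ i * a i| ≤ a K := by
  have h := alternating_sum_mem_Icc (fun i => a (K + i)) (fun x y hxy => ha (by omega))
    (fun k => h0 _) (N - K)
  rw [sum_Ico_eq_sum_range]
  simp only [pow_add, mul_assoc, ← mul_sum]
  rw [abs_mul, abs_pow, abs_neg, abs_one, one_pow, one_mul, abs_of_nonneg h.1]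
  exact h.2

/-- Dominated convergence for alternating series with antitone coefficients. -/
theorem tendsto_alternating_sum (c : ℕ → ℕ → ℝ) (d : ℕ → ℝ) (l : ℝ)
    (hc : ∀ N, Antitone (c N)) (hc0 : ∀ N k, 0 ≤ c N k) (hcd : ∀ N k, c N k ≤ d k)
    (hd : Antitone d) (hd0 : Tendsto d atTop (𝓝 0))
    (hlim : ∀ k, Tendsto (fun N => c N k) atTop (𝓝 (d k)))
    (hl : Tendsto (fun N => ∑ k ∈ range N, (-1 : ℝ) ^ k * d k) atTop (𝓝 l)) :
    Tendsto (fun N => ∑ k ∈ range N, (-1 : ℝ) ^ k * c N k) atTop (𝓝 l) := by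
  suffices h : Tendsto (fun N => ∑ k ∈ range N, (-1 : ℝ) ^ k * c N k
      - ∑ k ∈ range N, (-1 : ℝ) ^ k * d k) atTop (𝓝 0) by
    simpa using h.add hl
  rw [Metric.tendsto_atTop]
  intro ε hε
  -- Both tails beyond `K` are at most `d K < ε / 4`, uniformly in `N`; the head gets `ε / 2`.
  obtain ⟨K, hK⟩ := (hd0.eventually (gt_mem_nhds (show 0 < ε / 4 by positivity))).exists
  have hhead : Tendsto (fun N => ∑ k ∈ range K, (-1 : ℝ) ^ k * c N k
      - ∑ k ∈ range K, (-1 : ℝ) ^ k * d k) atTop (𝓝 0) := by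
    have := (tendsto_finsetSum (range K) fun k _ => (hlim k).const_mul ((-1 : ℝ) ^ k)).sub_const
      (∑ k ∈ range K, (-1 : ℝ) ^ k * d k)
    simpa using this
  obtain ⟨N₀, hN₀⟩ := Metric.tendsto_atTop.1 hhead (ε / 2) (by positivity)
  refine ⟨max K N₀, fun N hN => ?_⟩
  have h1 := hN₀ N (le_of_max_le_right hN)
  have h2 := abs_alternating_sum_Ico_le (c N) (hc N) (hc0 N) K N
  have h3 := abs_alternating_sum_Ico_le d hd (fun k => (hc0 0 k).trans (hcd 0 k)) K N
  have h4 := hcd N K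
  rw [Real.dist_eq, sub_zero] at h1 ⊢
  rw [← sum_range_add_sum_Ico _ (le_of_max_le_left hN),
    ← sum_range_add_sum_Ico (fun k => (-1 : ℝ) ^ k * d k) (le_of_max_le_left hN)]
  rw [abs_lt] at h1 ⊢
  rw [abs_le] at h2 h3
  constructor <;> linarith [h1.1, h1.2, h2.1, h2.2, h3.1, h3.2]

theorem sum_choose_mul_zetaStarTwo (j N : ℕ) :
    ∑ n ∈ range N, ((2 * (n + 1)).choose (n + 1) : ℝ) / (((n : ℝ) + 1) * 4 ^ (n + 1)) *
        zetaStarTwo (n + 1) j =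
      2 * ∑ k ∈ range N, (-1 : ℝ) ^ k *
        ((1 - walkBelow N (k + 1)) / ((k : ℝ) + 1) ^ (2 * j + 1)) := by
  have hterm : ∀ n ∈ range N,
      ((2 * (n + 1)).choose (n + 1) : ℝ) / (((n : ℝ) + 1) * 4 ^ (n + 1)) * zetaStarTwo (n + 1) j =
      ∑ k ∈ range N, 2 * ((-1 : ℝ) ^ k / ((k : ℝ) + 1) ^ (2 * j)) *
        (walkProb (n + 1) (k + 1) / ((n : ℝ) + 1)) := by
    intro n hn
    -- The common cutoff `N` for every `n` makes the double sum rectangular.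
    rw [div_mul_eq_mul_div, choose_mul_zetaStarTwo j (n + 1) N (by simp) (mem_range.1 hn),
      mul_sum, sum_div]
    refine sum_congr rfl fun k _ => ?_
    unfold walkProb
    field_simp
  rw [sum_congr rfl hterm, sum_comm, mul_sum]
  refine sum_congr rfl fun k _ => ?_
  rw [← mul_sum, sum_walkProb_div, pow_succ]
  field_simp

theorem tendsto_sum_choose_mul_zetaStarTwo (j : ℕ) :
    Tendsto (fun N => ∑ n ∈ range N,
      ((2 * (n + 1)).choose (n + 1) : ℝ) / (((n : ℝ) + 1) * 4 ^ (n + 1)) * zetaStarTwo (n + 1) j)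
      atTop (𝓝 (2 * dirichletEta (2 * (j : ℝ) + 1))) := by
  simp only [sum_choose_mul_zetaStarTwo]
  refine Tendsto.const_mul 2 ?_
  have hanti : Antitone fun k : ℕ => 1 / ((k : ℝ) + 1) ^ (2 * j + 1) := fun a b hab => by
    dsimp only
    gcongr
  refine tendsto_alternating_sum
    (fun N k => (1 - walkBelow N (k + 1)) / ((k : ℝ) + 1) ^ (2 * j + 1))
    (fun k => 1 / ((k : ℝ) + 1) ^ (2 * j + 1)) _ ?_ ?_ ?_ hanti ?_ ?_ ?_
  · intro N a b hab
    have h1 := walkBelow_mono N (Nat.succ_le_succ hab)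
    have h2 := walkBelow_le_one N a
    dsimp only
    gcongr
  · intro N k
    have := walkBelow_le_one N k
    exact div_nonneg (by linarith) (by positivity)
  · intro N k
    have := walkBelow_nonneg N (k + 1)
    gcongr
    linarith
  · refine squeeze_zero (fun k => by positivity) (fun k => ?_)
      tendsto_one_div_add_atTop_nhds_zero_nat
    gcongr
    exact le_self_pow₀ (by simp) (by simp)
  · intro k
    have := ((tendsto_walkBelow (k + 1)).const_sub 1).div_const (((k : ℝ) + 1) ^ (2 * j + 1))
    simpa using this
  · have h := tendsto_dirichletEta (s := 2 * (j : ℝ) + 1) (by positivity)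
    refine h.congr fun N => sum_congr rfl fun k _ => ?_
    rw [mul_one_div, ← Real.rpow_natCast _ (2 * j + 1)]
    push_cast
    rfl

theorem mainTheorem3 (j : ℕ) :
    HasSum
      (fun n : ℕ+ =>
        (Nat.choose (2 * (n : ℕ)) (n : ℕ) : ℝ) / ((n : ℝ) * 4 ^ (n : ℕ)) * zetaStarTwo (n : ℕ) j)
      (2 * dirichletEta (2 * (j : ℝ) + 1)) := by
  rw [← Equiv.pnatEquivNat.symm.hasSum_iff, hasSum_iff_tendsto_nat_of_nonneg]
  · simpa using tendsto_sum_choose_mul_zetaStarTwo j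
  · intro n
    exact mul_nonneg (by positivity) (zetaStarTwo_nonneg _ _)
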